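/- **Setting.** Let $n,t_s,t_a$ be natural numbers with $t_a\le t_s<n$, let $\Delta\ge 1$ be an integer, and let $V_{\mathrm{in}},V_{\mathrm{out}}$ be sets of (effectively encoded) finite objects; in particular they are at most countable. There are $n$ parties $P_1,\dots,P_n$. An *input configuration* is a set $I$ of pairs $(v,P)$ with $v\in V_{\mathrm{in}}$ and $P$ a party, containing at most one pair for each party, and with $|I|\ge n-t_s$; its parties are the honest ones, with their inputs, and all other parties are corrupted. Let $\mathcal I$ be the set of input configurations. A *validity property* is a map $\mathcal V:\mathcal I\to 2^{V_{\mathrm{out}}}$. **Network-agnostic model.** Time is discrete, and links between parties are authenticated. A protocol is an algorithm: at each of its steps a party computes the messages it sends (at most one to each party), and possibly an output, from its identity, its input, a finite number (computable from the number of the step) of fair random bits from its private tape and from a public tape, and the messages it has received so far. A central adversary, with the set of corrupted parties fixed in advance, sees all messages sent, the public random bits and the random bits of the corrupted parties, chooses the messages of the corrupted parties arbitrarily, and schedules message deliveries and the steps of the parties. In a *synchronous* network all honest parties take a step at each time and each message to an honest party is delivered at most $\Delta$ time units after it was sent; in an *asynchronous* network each honest party takes infinitely many steps and each message to an honest party is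 eventually delivered. The protocol does not know the type of the network. We consider both the setting without cryptographic setup, where the adversary is computationally unbounded, and the setting with a public key infrastructure, where messages may carry perfectly unforgeable signatures (a party can attach its own signatures and those it has received; corrupted parties can attach signatures of corrupted parties and those seen by the adversary) and the adversary is an algorithm. In either setting, $\mathcal V$ is *solvable in the network-agnostic model* if there is a protocol such that, for every input configuration $I$ and every adversary, whenever the network is synchronous (so at most $t_s$ parties are corrupted), or the network is asynchronous and $|I|\ge n-t_a$ (at most $t_a$ parties are corrupted): - (probabilistic termination) for each honest party, the probability that it has not produced an output by time $t$ tends to $0$ as $t\to\infty$; - (agreement) in every execution, all values output by honest parties are equal; - (validity) in every execution, every value output by an honest party is in $\mathcal V(I)$. **Similarity condition.** For $I\in\mathcal I$ let $\mathrm{neigh}(I)$ be the set of all $J\in\mathcal I$ such that every party occurring in both $I$ and $J$ has the same input in both, and let $$\mathrm{sim}(I)=\{J\in \mathrm{neigh}(I): J\subseteq I\}\cup\{J\in\mathrm{neigh}(I): |J|\ge n-t_a\}.$$ $\mathcal V$ satisfies the *similarity condition* if there is a Turing-computable function $\sigma:\mathcal I\to V_{\mathrm{out}}$ such that $\sigma(I)\in\bigcap_{J\in\mathrm{sim}(I)}\mathcal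 V(J)$ for every $I\in\mathcal I$. **Lemma.** In each of the two cryptographic settings: if a validity property $\mathcal V$ is solvable in the network-agnostic model, then $\mathcal V$ satisfies the similarity condition. -/

import Mathlib

open MeasureTheory

namespace BA

/-! ### Input configurations and validity properties -/

/-- The set of (honest) parties of an assignment of inputs to some of the `n` parties. -/
def parties {n : ℕ} {Vin : Type*} (I : Fin n → Option Vin) : Finset (Fin n) :=
  Finset.univ.filter fun p => (I p).isSome

/-- Input configurations: sets of pairs (input, party), at most one pair for each party,
with at least `n - ts` pairs. They are given as partial functions from parties to inputs;
the parties outside the domain are the corrupted ones. -/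
def InputConfig (n ts : ℕ) (Vin : Type*) : Type _ :=
  {I : Fin n → Option Vin // n ≤ (parties I).card + ts}

/-- A validity property maps each input configuration to its set of valid outputs. -/
abbrev ValidityProperty (n ts : ℕ) (Vin Vout : Type*) : Type _ :=
  InputConfig n ts Vin → Set Vout

/-- `J ⊆ I` -/
def InputConfig.Sub {n ts : ℕ} {Vin : Type*} (J I : InputConfig n ts Vin) : Prop :=
  ∀ p v, J.1 p = some v → I.1 p = some v

/-- The neighbors of `I`: the configurations that give the same input as `I` to each common
party. -/
def neighbors {n ts : ℕ} {Vin : Type*} (I : InputConfig n ts Vin) :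
    Set (InputConfig n ts Vin) :=
  {J | ∀ p v₁ v₂, I.1 p = some v₁ → J.1 p = some v₂ → v₁ = v₂}

/-- The configurations similar to `I`. -/
def similar {n ts : ℕ} {Vin : Type*} (ta : ℕ) (I : InputConfig n ts Vin) :
    Set (InputConfig n ts Vin) :=
  {J ∈ neighbors I | J.Sub I} ∪ {J ∈ neighbors I | n ≤ (parties J.1).card + ta}

/-- Some program halts on every input configuration `I`, with result `σ I`. -/
def TuringComputable {n ts : ℕ} {Vin Vout : Type*} [Primcodable Vin] [Primcodable Vout]
    (σ : InputConfig n ts Vin → Vout) : Prop :=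
  ∃ f : (Fin n → Option Vin) →. Vout, Partrec f ∧ ∀ I : InputConfig n ts Vin, σ I ∈ f I.1

/-- The similarity condition. -/
def SimilarityCondition {n ts : ℕ} {Vin Vout : Type*} [Primcodable Vin] [Primcodable Vout]
    (ta : ℕ) (Val : ValidityProperty n ts Vin Vout) : Prop :=
  ∃ σ : InputConfig n ts Vin → Vout,
    TuringComputable σ ∧ ∀ I, σ I ∈ ⋂ J ∈ similar ta I, Val J

/-! ### Messages, protocols, adversaries -/

/-- The two cryptographic settings: no setup at all, or a public key infrastructure with
perfectly unforgeable signatures. -/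
inductive Setup
  | plain
  | pki

/-- The two types of networks. -/
inductive Network
  | synchronous
  | asynchronous

/-- `(p, x)` stands for the signature of party `p` on the content `x`. -/
abbrev Signature (n : ℕ) : Type := Fin n × ℕ

/-- A message: a payload (a number that may encode any data), and attached signatures. -/
abbrev Msg (n : ℕ) : Type := ℕ × List (Signature n)

/-- The messages sent at one instant: `r p q` is the message from `p` to `q`, if any. -/
abbrev Round (n : ℕ) : Type := Fin n → Fin n → Option (Msg n)

/-- The messages that a party receives at one of its steps, with their true senders (links are
authenticated). -/
abbrev Inbox (n : ℕ) : Type := List (Fin n × Msg n)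

/-- What remains of a message when its sender may use only the signatures allowed by `ok`.
Without setup there are no signatures. -/
def Setup.restrict {n : ℕ} (S : Setup) (ok : Signature n → Bool) (m : Msg n) : Msg n :=
  match S with
  | .plain => (m.1, [])
  | .pki => (m.1, m.2.filter ok)

/-- A randomized protocol for `n` parties. In its `k`-th step a party computes the messages that
it sends, and possibly an output, from its identity, its input, the first `coins k` bits of its
private random tape and of the public one, and the messages received in each of its
steps so far, including this one. -/
structure Protocol (n : ℕ) (Vin Vout : Type*) [Primcodable Vin] [Primcodable Vout] where
  coins : ℕ → ℕ
  coins_mono : Monotone coins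
  coins_computable : Computable coins
  act : Fin n → Vin → List Bool → List Bool → List (Inbox n) →
    (Fin n → Option (Msg n)) × Option Vout
  act_computable : Computable
    (fun x : Fin n × Vin × List Bool × List Bool × List (Inbox n) =>
      act x.1 x.2.1 x.2.2.1 x.2.2.2.1 x.2.2.2.2)

/-- What the adversary sees: the coins of each corrupted party (the empty list for an honest
one), the public coins, and all messages sent so far, one entry for each instant. -/
abbrev AdvView (n : ℕ) : Type := (Fin n → List Bool) × List Bool × List (Round n)

/-- A strategy of the central adversary. `send` gives the messages of the corrupted parties
(the view then includes the messages that honest parties send at the same instant),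
`deliver view s p q` tells whether the message sent from `p` to `q` at time `s`
is to be delivered now, and `active` tells which parties take a step now. -/
structure Adversary (n : ℕ) where
  send : AdvView n → Fin n → Fin n → Option (Msg n)
  deliver : AdvView n → ℕ → Fin n → Fin n → Bool
  active : AdvView n → Fin n → Bool

/-- The strategy is carried out by an algorithm. -/
def Adversary.IsComputable {n : ℕ} (A : Adversary n) : Prop :=
  Computable (fun x : AdvView n × Fin n × Fin n => A.send x.1 x.2.1 x.2.2) ∧
  Computable (fun x : AdvView n × ℕ × Fin n × Fin n =>
    A.deliver x.1 x.2.1 x.2.2.1 x.2.2.2) ∧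
  Computable (fun x : AdvView n × Fin n => A.active x.1 x.2)

/-- The adversaries of the two settings: computationally unbounded without cryptographic setup,
algorithmic with it. -/
def Setup.Allows {n : ℕ} (S : Setup) (A : Adversary n) : Prop :=
  match S with
  | .plain => True
  | .pki => A.IsComputable

/-! ### Randomness -/

/-- Random tapes: `ω (some p, ·)` is the private tape of `p`, `ω (none, ·)` the public tape. -/
abbrev Coins (n : ℕ) : Type := Option (Fin n) × ℕ → Bool

/-- All bits of all tapes are independent fair coins. -/
noncomputable def coinMeasure (n : ℕ) : Measure (Coins n) :=
  Measure.infinitePi fun _ => (PMF.uniformOfFintype Bool).toMeasure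

/-- The first `k` bits of a tape. -/
def firstCoins {n : ℕ} (ω : Coins n) (i : Option (Fin n)) (k : ℕ) : List Bool :=
  (List.range k).map fun j => ω (i, j)

/-! ### Executions -/

section Execution

variable {n : ℕ} {Vin Vout : Type*} [Primcodable Vin] [Primcodable Vout]
  (S : Setup) (P : Protocol n Vin Vout) (A : Adversary n) (I : Fin n → Option Vin) (ω : Coins n)

/-- The view of the adversary when the messages `h` have been sent. -/
def advView (h : List (Round n)) : AdvView n :=
  (fun p => if (I p).isSome then [] else firstCoins ω (some p) (P.coins h.length),
    firstCoins ω none (P.coins h.length), h)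

/-- Whether `p` takes a step at time `t`; here and below `h` holds the messages sent at the times
`0, 1, 2, …`, at least those before `t`. -/
def isActive (h : List (Round n)) (t : ℕ) (p : Fin n) : Bool :=
  A.active (advView P I ω (h.take t)) p

/-- Whether `q` takes a step at time `t` and the adversary lets it receive then the message
sent by `p` at time `s`. -/
def isOffered (h : List (Round n)) (t s : ℕ) (p q : Fin n) : Bool :=
  isActive P A I ω h t q && A.deliver (advView P I ω (h.take t)) s p q

/-- Whether the message from `p` to `q` sent at time `s` arrives at time `t`. -/
def arrives (h : List (Round n)) (t s : ℕ) (p q : Fin n) : Bool :=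
  decide (s < t) && isOffered P A I ω h t s p q &&
    decide (∀ t' < t, s < t' → isOffered P A I ω h t' s p q = false)

/-- The message sent from `p` to `q` at time `s`, if any. -/
def sentAt (h : List (Round n)) (s : ℕ) (p q : Fin n) : Option (Msg n) :=
  h.getD s (fun _ _ => none) p q

/-- The messages that arrive at `q` at time `t`. -/
def inbox (h : List (Round n)) (t : ℕ) (q : Fin n) : Inbox n :=
  (List.range t).flatMap fun s => (List.finRange n).filterMap fun p =>
    if arrives P A I ω h t s p q then (sentAt h s p q).map fun m => (p, m) else none

/-- The messages received by `p` in each of its steps up to time `t`. -/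
def received (h : List (Round n)) (t : ℕ) (p : Fin n) : List (Inbox n) :=
  ((List.range (t + 1)).filter fun t' => isActive P A I ω h t' p).map
    fun t' => inbox P A I ω h t' p

/-- What the honest party `p` does at time `t`: the messages it sends, and its output if it has
one. Nothing if `p` is corrupted or takes no step at time `t`. -/
def honestStep (h : List (Round n)) (t : ℕ) (p : Fin n) :
    (Fin n → Option (Msg n)) × Option Vout :=
  match I p with
  | none => (fun _ => none, none)
  | some v =>
    if isActive P A I ω h t p then
      let r := received P A I ω h t p
      P.act p v (firstCoins ω (some p) (P.coins r.length))
        (firstCoins ω none (P.coins r.length)) r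
    else (fun _ => none, none)

/-- The messages that honest parties send at time `t`. An honest party can attach its
own signatures and those that it has received. -/
def honestRound (h : List (Round n)) (t : ℕ) : Round n := fun p q =>
  ((honestStep P A I ω h t p).1 q).map <| S.restrict fun x =>
    decide (x.1 = p) ||
      (received P A I ω h t p).any fun b => b.any fun y => decide (x ∈ y.2.2)

/-- Whether the signature `x` is attached to one of the messages `h`. -/
def hasAppeared (h : List (Round n)) (x : Signature n) : Bool :=
  h.any fun r => (List.finRange n).any fun p => (List.finRange n).any fun q =>
    (r p q).any fun m => decide (x ∈ m.2)

/-- All messages sent at the time following those of `h`. A corrupted party can attach the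
signatures of corrupted parties and those that the adversary has seen. -/
def nextRound (h : List (Round n)) : Round n :=
  let h' := h ++ [honestRound S P A I ω h h.length]
  fun p q =>
    if (I p).isSome then honestRound S P A I ω h h.length p q
    else (A.send (advView P I ω h') p q).map <| S.restrict fun x =>
      (I x.1).isNone || hasAppeared h' x

/-- All messages sent before time `t`, in the execution of the protocol `P` with input
configuration `I`, adversary `A` and randomness `ω`. -/
def transcript : ℕ → List (Round n)
  | 0 => []
  | t + 1 => transcript t ++ [nextRound S P A I ω (transcript t)]

/-- The output that the honest party `p` produces at time `t`, if any. -/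
def outputAt (t : ℕ) (p : Fin n) : Option Vout :=
  (honestStep P A I ω (transcript S P A I ω t) t p).2

/-- The guarantees of the network. Synchronous: all clocks run in step, and each message to
an honest party arrives at most `Δ` after it was sent. Asynchronous: each
honest party keeps taking steps, and each message to it arrives eventually. -/
def RespectsNetwork (Δ : ℕ) (net : Network) : Prop :=
  match net with
  | .synchronous =>
    (∀ t, ∀ p ∈ parties I, isActive P A I ω (transcript S P A I ω t) t p = true) ∧
    ∀ s p, ∀ q ∈ parties I, (sentAt (transcript S P A I ω (s + 1)) s p q).isSome →
      ∃ t ≤ s + Δ, arrives P A I ω (transcript S P A I ω t) t s p q = true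
  | .asynchronous =>
    (∀ p ∈ parties I, ∀ t₀, ∃ t ≥ t₀, isActive P A I ω (transcript S P A I ω t) t p = true) ∧
    ∀ s p, ∀ q ∈ parties I, (sentAt (transcript S P A I ω (s + 1)) s p q).isSome →
      ∃ t, arrives P A I ω (transcript S P A I ω t) t s p q = true

/-- The probability that a given honest party has not decided by time `t` tends to `0`. -/
def ProbabilisticTermination : Prop :=
  ∀ p ∈ parties I, Filter.Tendsto
    (fun t : ℕ => coinMeasure n {ω | ∀ t' ≤ t, outputAt S P A I ω t' p = none})
    Filter.atTop (nhds 0)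

/-- In no execution do honest parties output different values. -/
def Agreement : Prop :=
  ∀ ω, ∀ p ∈ parties I, ∀ q ∈ parties I, ∀ t t' v v',
    outputAt S P A I ω t p = some v → outputAt S P A I ω t' q = some v' → v = v'

/-- In no execution does an honest party output a value outside `W`. -/
def OutputsIn (W : Set Vout) : Prop :=
  ∀ ω, ∀ p ∈ parties I, ∀ t v, outputAt S P A I ω t p = some v → v ∈ W

end Execution

/-! ### Solvability -/

/-- The number of corruptions allowed in each type of network. -/
def Network.threshold (ts ta : ℕ) : Network → ℕ
  | .synchronous => ts
  | .asynchronous => ta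

/-- `P` is a `(ts, ta)`-secure protocol solving the validity property `Val`. -/
def Secure {n ts : ℕ} {Vin Vout : Type*} [Primcodable Vin] [Primcodable Vout]
    (S : Setup) (Δ ta : ℕ) (Val : ValidityProperty n ts Vin Vout)
    (P : Protocol n Vin Vout) : Prop :=
  ∀ (net : Network) (I : InputConfig n ts Vin),
    n ≤ (parties I.1).card + net.threshold ts ta →
    ∀ A : Adversary n, S.Allows A → (∀ ω, RespectsNetwork S P A I.1 ω Δ net) →
      ProbabilisticTermination S P A I.1 ∧ Agreement S P A I.1 ∧ OutputsIn S P A I.1 (Val I)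

/-- `Val` is solvable in the network-agnostic model with delay bound `Δ`. -/
def Solvable {n ts : ℕ} {Vin Vout : Type*} [Primcodable Vin] [Primcodable Vout]
    (S : Setup) (Δ ta : ℕ) (Val : ValidityProperty n ts Vin Vout) : Prop :=
  ∃ P : Protocol n Vin Vout, Secure S Δ ta Val P

end BA

namespace BA

/-! ### Scheduled adversaries -/

section Scheduled

variable {n : ℕ}

/-! Let σ(I) be the output of some terminating run in which the parties of I are honest, all others
are silent and every message arrives at the next instant. This network is synchronous, so
probabilistic termination gives such a run. A decision depends on finitely many coins only, so a
decisive run can be found by an exhaustive search over finitely supported tapes, times and parties;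
this makes σ computable (`partrec_firstDecision`, `Secure.firstDecision_dom`).

To see that an output v, produced at time T, is valid for every J similar to I, choose a
configuration K containing both I and J: K = I if J ⊆ I, and K = I ∪ J if |J| ≥ n - ta. Make the
parties of K honest, but let those outside I sleep until T. Up to T this cannot be told apart from
the original run, so v is output again (`outputAt_delayed`). If K = I nobody honest sleeps and the
network is synchronous; otherwise it is asynchronous, with at most ta corruptions. The coins fixed
so far have positive probability, so in some continuation a party q of J also decides, and by
agreement its output is v.

Finally let only J be honest, while the corrupted parties of K \ J follow the protocol with their
inputs from K. The run does not change (`outputAt_imitate`), and validity for J puts the output v of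
q into V(J). The imitating adversary must be legal: it is computable because the protocol is, it
sees the private coins of the parties that it plays, and it has seen every signature they could
forward. -/

/-- The schedule in which the parties in `D` take a step at each time, and all others at each time
from `T` on. -/
def activeAt (D : Fin n → Bool) (T t : ℕ) (p : Fin n) : Bool :=
  D p || decide (T ≤ t)

/-- The adversary that activates the parties according to `activeAt D T`, and has each message
received in the next step of its recipient. -/
def scheduled (D : Fin n → Bool) (T : ℕ) (send : AdvView n → Fin n → Fin n → Option (Msg n)) :
    Adversary n where
  send := send
  deliver _ _ _ _ := true
  active view p := activeAt D T view.2.2.length p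

/-- The corrupted parties do not send any message. -/
def silent : AdvView n → Fin n → Fin n → Option (Msg n) := fun _ _ _ => none

/-- Whether a message sent to `q` at time `s` arrives at time `t` under the schedule. -/
def arrivesAt (D : Fin n → Bool) (T t s : ℕ) (q : Fin n) : Bool :=
  decide (s < t) && (activeAt D T t q && (decide (t ≤ s + 1) || !activeAt D T (t - 1) q))

/-- The messages that arrive at `q` at time `t` under the schedule. -/
def inboxAt (D : Fin n → Bool) (T : ℕ) (h : List (Round n)) (t : ℕ) (q : Fin n) : Inbox n :=
  (List.range t).flatMap fun s => (List.finRange n).filterMap fun p =>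
    if arrivesAt D T t s q then (sentAt h s p q).map fun m => (p, m) else none

/-- The messages received by `p` in its steps up to time `t` under the schedule. -/
def receivedAt (D : Fin n → Bool) (T : ℕ) (h : List (Round n)) (t : ℕ) (p : Fin n) :
    List (Inbox n) :=
  ((List.range (t + 1)).filter fun t' => activeAt D T t' p).map fun t' => inboxAt D T h t' p

/-- The signatures that `p` may attach after having received `r`. -/
def mayAttach (r : List (Inbox n)) (p : Fin n) (x : Signature n) : Bool :=
  decide (x.1 = p) || r.any fun b => b.any fun y => decide (x ∈ y.2.2)

/-- A party takes at most one step per instant, so up to time t it uses at most `P.coins (t + 1)`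
bits of each tape. -/
lemma length_receivedAt_le (D : Fin n → Bool) (T : ℕ) (h : List (Round n)) (t : ℕ) (p : Fin n) :
    (receivedAt D T h t p).length ≤ t + 1 := by
  rw [receivedAt, List.length_map]
  exact (List.length_filter_le _ _).trans (by simp)

lemma activeAt_mono {D : Fin n → Bool} {T t t' : ℕ} {p : Fin n} (htt : t ≤ t')
    (h : activeAt D T t p = true) : activeAt D T t' p = true := by
  simp only [activeAt, Bool.or_eq_true, decide_eq_true_eq] at h ⊢
  exact h.imp_right fun h => h.trans htt

lemma inboxAt_congr {D D' : Fin n → Bool} {T T' : ℕ} {q : Fin n}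
    (hq : ∀ t, activeAt D T t q = activeAt D' T' t q) (h : List (Round n)) (t : ℕ) :
    inboxAt D T h t q = inboxAt D' T' h t q := by
  have : ∀ s, arrivesAt D T t s q = arrivesAt D' T' t s q := fun s => by
    simp only [arrivesAt, hq]
  simp only [inboxAt, this]

lemma receivedAt_congr {D D' : Fin n → Bool} {T T' : ℕ} {q : Fin n}
    (hq : ∀ t, activeAt D T t q = activeAt D' T' t q) (h : List (Round n)) (t : ℕ) :
    receivedAt D T h t q = receivedAt D' T' h t q := by
  simp only [receivedAt, hq, inboxAt_congr hq]

lemma mayAttach_iff {r : List (Inbox n)} {p : Fin n} {x : Signature n} :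
    mayAttach r p x = true ↔ x.1 = p ∨ ∃ b ∈ r, ∃ y ∈ b, x ∈ y.2.2 := by
  simp [mayAttach]

lemma hasAppeared_of_sentAt {h : List (Round n)} {s : ℕ} {p q : Fin n} {m : Msg n}
    (hm : sentAt h s p q = some m) {x : Signature n} (hx : x ∈ m.2) : hasAppeared h x = true := by
  have hs : s < h.length := by
    by_contra hs
    rw [sentAt, List.getD_eq_default _ _ (not_lt.1 hs)] at hm
    simp at hm
  rw [sentAt, List.getD_eq_getElem _ _ hs] at hm
  simp only [hasAppeared, List.any_eq_true]
  refine ⟨h[s], List.getElem_mem hs, p, List.mem_finRange p, q, List.mem_finRange q, ?_⟩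
  simp [hm, hx]

/-- Whatever a party has received was sent earlier, hence seen by the adversary. So unforgeability
does not hinder the imitation of honest parties. -/
lemma hasAppeared_of_mayAttach {D : Fin n → Bool} {T : ℕ} {h : List (Round n)} {t : ℕ}
    {p : Fin n} {x : Signature n} (hx : mayAttach (receivedAt D T h t p) p x = true) :
    x.1 = p ∨ hasAppeared h x = true := by
  refine (mayAttach_iff.1 hx).imp_right ?_
  rintro ⟨b, hb, y, hy, hxy⟩
  obtain ⟨t', -, rfl⟩ := List.mem_map.1 hb
  obtain ⟨s, -, hs⟩ := List.mem_flatMap.1 hy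
  obtain ⟨q, -, hq⟩ := List.mem_filterMap.1 hs
  split_ifs at hq
  obtain ⟨m, hm, rfl⟩ := Option.map_eq_some_iff.1 hq
  exact hasAppeared_of_sentAt hm hxy

lemma hasAppeared_append {h h' : List (Round n)} {x : Signature n} (hx : hasAppeared h x = true) :
    hasAppeared (h ++ h') x = true := by
  rw [hasAppeared, List.any_append, Bool.or_eq_true]
  exact Or.inl hx

/-- An imitated message is filtered twice: by what the imitated party may attach, then by what the
adversary may attach. The second, weaker filter removes nothing more. -/
lemma Setup.restrict_restrict (S : Setup) {ok ok' : Signature n → Bool}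
    (H : ∀ x, ok x = true → ok' x = true) (m : Msg n) :
    S.restrict ok' (S.restrict ok m) = S.restrict ok m := by
  cases S
  · rfl
  · simp only [Setup.restrict, List.filter_filter]
    congr 2
    funext x
    by_cases hx : ok x = true
    · simp [hx, H x hx]
    · simp [hx]

end Scheduled

section ScheduledExecution

variable {n : ℕ} {Vin Vout : Type*} [Primcodable Vin] [Primcodable Vout]
  (S : Setup) (P : Protocol n Vin Vout) (D : Fin n → Bool) (T : ℕ)
  (send : AdvView n → Fin n → Fin n → Option (Msg n))
  (I : Fin n → Option Vin) (ω : Coins n)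

/-- What the honest party `p` does at time `t` under the schedule, where `a` and `b` start with the
bits that it may use of its private tape and of the public one. -/
def scheduledStep (a b : List Bool) (h : List (Round n)) (t : ℕ) (p : Fin n) :
    (Fin n → Option (Msg n)) × Option Vout :=
  match I p with
  | none => (fun _ => none, none)
  | some v =>
    if activeAt D T t p then
      P.act p v (a.take (P.coins (receivedAt D T h t p).length))
        (b.take (P.coins (receivedAt D T h t p).length)) (receivedAt D T h t p)
    else (fun _ => none, none)

/-- The message that `p` sends to `q` at time `t` under the schedule. -/
def scheduledMsg (a b : List Bool) (h : List (Round n)) (t : ℕ) (p q : Fin n) : Option (Msg n) :=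
  ((scheduledStep P D T I a b h t p).1 q).map
    (S.restrict (mayAttach (receivedAt D T h t p) p))

@[simp]
lemma length_transcript (A : Adversary n) (t : ℕ) : (transcript S P A I ω t).length = t := by
  induction t with
  | zero => rfl
  | succ t ih => simp [transcript, ih]

lemma take_firstCoins (i : Option (Fin n)) {k l : ℕ} (hkl : k ≤ l) :
    (firstCoins ω i l).take k = firstCoins ω i k := by
  simp [firstCoins, ← List.map_take, List.take_range, min_eq_left hkl]

variable {h : List (Round n)} {t : ℕ}

lemma isActive_scheduled (ht : t ≤ h.length) (p : Fin n) :
    isActive P (scheduled D T send) I ω h t p = activeAt D T t p := by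
  simp [isActive, scheduled, advView, min_eq_left ht]

lemma isOffered_scheduled (ht : t ≤ h.length) (s : ℕ) (p q : Fin n) :
    isOffered P (scheduled D T send) I ω h t s p q = activeAt D T t q := by
  rw [isOffered, isActive_scheduled P D T send I ω ht]
  simp [scheduled]

/-- Under the schedule a party that has woken up stays awake. So "not offered at any time strictly
between s and t" needs checking at t - 1 only. -/
lemma arrives_scheduled (ht : t ≤ h.length) (s : ℕ) (p q : Fin n) :
    arrives P (scheduled D T send) I ω h t s p q = arrivesAt D T t s q := by
  rw [Bool.eq_iff_iff]
  simp only [arrives, isOffered_scheduled P D T send I ω ht, arrivesAt, Bool.and_eq_true,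
    decide_eq_true_eq, Bool.or_eq_true, Bool.not_eq_true', and_assoc]
  refine and_congr_right fun hst => and_congr_right fun _ => ?_
  constructor
  · intro H
    by_cases hs : t ≤ s + 1
    · exact Or.inl hs
    · right
      have := H (t - 1) (by omega) (by omega)
      rwa [isOffered_scheduled P D T send I ω (by omega)] at this
  · intro H t' ht' hst'
    rw [isOffered_scheduled P D T send I ω (by omega)]
    rcases H with H | H
    · omega
    · by_contra hc
      rw [Bool.not_eq_false] at hc
      have := activeAt_mono (t' := t - 1) (by omega) hc
      simp [H] at this

lemma inbox_scheduled (ht : t ≤ h.length) (q : Fin n) :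
    inbox P (scheduled D T send) I ω h t q = inboxAt D T h t q := by
  simp only [inbox, inboxAt, arrives_scheduled P D T send I ω ht]

lemma received_scheduled (ht : t ≤ h.length) (p : Fin n) :
    received P (scheduled D T send) I ω h t p = receivedAt D T h t p := by
  rw [received, receivedAt]
  have hfil : (List.range (t + 1)).filter
      (fun t' => isActive P (scheduled D T send) I ω h t' p) =
      (List.range (t + 1)).filter fun t' => activeAt D T t' p := by
    refine List.filter_congr fun t' ht' => ?_
    rw [List.mem_range] at ht'
    exact isActive_scheduled P D T send I ω (by omega) p
  rw [hfil]
  refine List.map_congr_left fun t' ht' => ?_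
  have := List.mem_range.1 (List.mem_filter.1 ht').1
  exact inbox_scheduled P D T send I ω (by omega) p

lemma honestStep_scheduled (ht : t ≤ h.length) {N : ℕ} (hN : P.coins (t + 1) ≤ N) (p : Fin n) :
    honestStep P (scheduled D T send) I ω h t p =
      scheduledStep P D T I (firstCoins ω (some p) N) (firstCoins ω none N) h t p := by
  have hle : P.coins (receivedAt D T h t p).length ≤ N :=
    (P.coins_mono (length_receivedAt_le D T h t p)).trans hN
  simp only [honestStep, scheduledStep, isActive_scheduled P D T send I ω ht,
    received_scheduled P D T send I ω ht, take_firstCoins ω _ hle]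

lemma honestRound_scheduled (ht : t ≤ h.length) {N : ℕ} (hN : P.coins (t + 1) ≤ N)
    (p q : Fin n) :
    honestRound S P (scheduled D T send) I ω h t p q =
      scheduledMsg S P D T I (firstCoins ω (some p) N) (firstCoins ω none N) h t p q := by
  rw [honestRound, scheduledMsg, honestStep_scheduled P D T send I ω ht hN,
    received_scheduled P D T send I ω ht]
  rfl

lemma scheduledMsg_of_none {p : Fin n} (hp : I p = none) (a b : List Bool) (q : Fin n) :
    scheduledMsg S P D T I a b h t p q = none := by
  simp [scheduledMsg, scheduledStep, hp]

lemma nextRound_silent {N : ℕ} (hN : P.coins (h.length + 1) ≤ N) (p q : Fin n) :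
    nextRound S P (scheduled D T silent) I ω h p q =
      scheduledMsg S P D T I (firstCoins ω (some p) N) (firstCoins ω none N) h h.length p q := by
  simp only [nextRound]
  split_ifs with hp
  · exact honestRound_scheduled S P D T silent I ω le_rfl hN p q
  · rw [scheduledMsg_of_none S P D T I (by simpa using hp)]
    simp [scheduled, silent]

lemma outputAt_scheduled {N : ℕ} (hN : P.coins (t + 1) ≤ N) (p : Fin n) :
    outputAt S P (scheduled D T send) I ω t p =
      (scheduledStep P D T I (firstCoins ω (some p) N) (firstCoins ω none N)
        (transcript S P (scheduled D T send) I ω t) t p).2 := by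
  rw [outputAt, honestStep_scheduled P D T send I ω (by simp) hN]

/-! ### The guarantees of the network -/

lemma respectsNetwork_synchronous {Δ : ℕ} (hΔ : 0 < Δ)
    (hD : ∀ p ∈ parties I, D p = true) :
    RespectsNetwork S P (scheduled D T send) I ω Δ .synchronous := by
  refine ⟨fun t p hp => ?_, fun s p q hq _ => ⟨s + 1, by omega, ?_⟩⟩
  · rw [isActive_scheduled P D T send I ω (by simp)]
    simp [activeAt, hD p hp]
  · rw [arrives_scheduled P D T send I ω (by simp)]
    simp [arrivesAt, activeAt, hD q hq]

/-- Everybody is awake from T on, and a message arrives at the first step of its recipient after it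
was sent. -/
lemma respectsNetwork_asynchronous (Δ : ℕ) :
    RespectsNetwork S P (scheduled D T send) I ω Δ .asynchronous := by
  refine ⟨fun p _ t₀ => ⟨max T t₀, le_max_right _ _, ?_⟩, fun s p q _ _ => ?_⟩
  · rw [isActive_scheduled P D T send I ω (by simp)]
    simp [activeAt]
  · have hex : ∃ t, s < t ∧ activeAt D T t q = true :=
      ⟨max T (s + 1), by omega, by simp [activeAt]⟩
    classical
    refine ⟨Nat.find hex, ?_⟩
    rw [arrives_scheduled P D T send I ω (by simp)]
    obtain ⟨h1, h2⟩ := Nat.find_spec hex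
    simp only [arrivesAt, Bool.and_eq_true, decide_eq_true_eq, Bool.or_eq_true,
      Bool.not_eq_true']
    refine ⟨h1, h2, or_iff_not_imp_left.2 fun h3 => ?_⟩
    have := Nat.find_min hex (m := Nat.find hex - 1) (by omega)
    by_contra hc
    exact this ⟨by omega, by simpa using hc⟩

/-! ### Delayed parties -/

/-- As long as the parties outside `D` do not take steps, the execution does not depend on whether
they are honest, and it depends on the first coins only. -/
lemma transcript_delayed {I K : Fin n → Option Vin} {ω ω' : Coins n} {T' : ℕ}
    (hI : ∀ p, (I p).isSome → D p = true) (hIK : ∀ p, D p = true → K p = I p)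
    (hω : ∀ i, ∀ j < P.coins T, ω' (i, j) = ω (i, j)) {t : ℕ} (ht : t ≤ T) :
    transcript S P (scheduled D T silent) K ω' t =
      transcript S P (scheduled (fun _ => true) T' silent) I ω t := by
  induction t with
  | zero => rfl
  | succ t ih =>
    rw [transcript, transcript, ih (by omega)]
    congr 2
    funext p q
    have hN : P.coins (t + 1) ≤ P.coins T := P.coins_mono ht
    have hf : ∀ i, firstCoins ω' i (P.coins T) = firstCoins ω i (P.coins T) := fun i =>
      List.map_congr_left fun j hj => hω i j (List.mem_range.1 hj)
    rw [nextRound_silent S P _ _ _ _ (N := P.coins T) (by simpa using hN),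
      nextRound_silent S P _ _ _ _ (N := P.coins T) (by simpa using hN), hf, hf]
    by_cases hp : D p = true
    · have hact : ∀ t, activeAt D T t p = activeAt (fun _ => true) T' t p := fun t => by
        simp [activeAt, hp]
      simp only [scheduledMsg, scheduledStep, hIK p hp, hact, receivedAt_congr hact]
    -- A party outside `D` sends nothing on either side: for `I` it is corrupted and silent, for `K`
    -- it is asleep, since t < T.
    · rw [scheduledMsg_of_none S P _ _ I (by
        by_contra hc
        exact hp (hI p (Option.isSome_iff_ne_none.2 hc)))]
      have hact : activeAt D T t p = false := by simp [activeAt, hp]; omega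
      simp only [length_transcript, scheduledMsg, scheduledStep, hact]
      cases K p <;> simp

/-- The delayed parties may already move at time T, but a step at T depends only on messages sent
before T. It may use one more block of coins than the transcript, hence the bound `P.coins (T + 1)`.
-/
lemma outputAt_delayed {I K : Fin n → Option Vin} {ω ω' : Coins n} {T' : ℕ}
    (hI : ∀ p, (I p).isSome → D p = true) (hIK : ∀ p, D p = true → K p = I p)
    (hω : ∀ i, ∀ j < P.coins (T + 1), ω' (i, j) = ω (i, j)) {p : Fin n} (hp : D p = true) :
    outputAt S P (scheduled D T silent) K ω' T p =
      outputAt S P (scheduled (fun _ => true) T' silent) I ω T p := by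
  have hf : ∀ i, firstCoins ω' i (P.coins (T + 1)) = firstCoins ω i (P.coins (T + 1)) := fun i =>
    List.map_congr_left fun j hj => hω i j (List.mem_range.1 hj)
  rw [outputAt_scheduled S P _ _ _ _ _ le_rfl, outputAt_scheduled S P _ _ _ _ _ le_rfl,
    transcript_delayed S P D T (T' := T') hI hIK
      (fun i j hj => hω i j (hj.trans_le (P.coins_mono (by omega)))) le_rfl, hf, hf]
  have hact : ∀ t, activeAt D T t p = activeAt (fun _ => true) T' t p := fun t => by
    simp [activeAt, hp]
  simp only [scheduledStep, hIK p hp, hact, receivedAt_congr hact]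

/-! ### Corrupted parties that follow the protocol -/

/-- The corrupted parties send what honest parties with the inputs `K` would send. -/
def imitate (K : Fin n → Option Vin) : AdvView n → Fin n → Fin n → Option (Msg n) :=
  fun view p q => scheduledMsg S P D T K (view.1 p) view.2.1 view.2.2.dropLast
    view.2.2.dropLast.length p q

/-- The message of a party is determined by its input, its private coins, the public coins and the
past messages. For a corrupted party the adversary knows all of these. -/
lemma nextRound_imitate {L K : Fin n → Option Vin} (hLK : ∀ p v, L p = some v → K p = some v)
    (h : List (Round n)) :
    nextRound S P (scheduled D T (imitate S P D T K)) L ω h =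
      nextRound S P (scheduled D T silent) K ω h := by
  funext p q
  rw [nextRound_silent S P D T K ω le_rfl]
  simp only [nextRound]
  cases hp : L p with
  | some v =>
    simp only [Option.isSome_some, if_true]
    rw [honestRound_scheduled S P D T _ L ω le_rfl le_rfl]
    simp only [scheduledMsg, scheduledStep, hp, hLK p v hp]
  | none =>
    simp only [Option.isSome_none, Bool.false_eq_true, if_false]
    -- The view used for sending already contains the honest messages of the current instant.
    -- `dropLast` removes them, and the view holds the `P.coins (h.length + 1)` bits that a step at
    -- time `h.length` may need.
    simp only [scheduled, imitate, advView, hp, List.dropLast_concat, List.length_append,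
      List.length_singleton, Option.isSome_none, Bool.false_eq_true, if_false]
    rw [scheduledMsg, Option.map_map]
    congr 1
    funext m
    refine S.restrict_restrict (fun x hx => ?_) m
    rcases hasAppeared_of_mayAttach hx with rfl | hx
    · simp [hp]
    · rw [hasAppeared_append hx, Bool.or_true]

lemma transcript_imitate {L K : Fin n → Option Vin} (hLK : ∀ p v, L p = some v → K p = some v)
    (t : ℕ) :
    transcript S P (scheduled D T (imitate S P D T K)) L ω t =
      transcript S P (scheduled D T silent) K ω t := by
  induction t with
  | zero => rfl
  | succ t ih => rw [transcript, transcript, ih, nextRound_imitate S P D T ω hLK]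

lemma outputAt_imitate {L K : Fin n → Option Vin} (hLK : ∀ p v, L p = some v → K p = some v)
    (t : ℕ) {p : Fin n} (hp : p ∈ parties L) :
    outputAt S P (scheduled D T (imitate S P D T K)) L ω t p =
      outputAt S P (scheduled D T silent) K ω t p := by
  obtain ⟨v, hv⟩ := Option.isSome_iff_exists.1 (Finset.mem_filter.1 hp).2
  rw [outputAt_scheduled S P _ _ _ _ _ le_rfl, outputAt_scheduled S P _ _ _ _ _ le_rfl,
    transcript_imitate S P D T ω hLK]
  simp only [scheduledStep, hv, hLK p v hv]

end ScheduledExecution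

/-! ### Computability -/

section Computability

variable {n : ℕ}

lemma computable_fin_curry {α σ : Type*} [Primcodable α] [Primcodable σ] {f : α → Fin n → σ}
    (hf : Computable₂ f) : Computable f :=
  (Primrec.vector_get'.to_comp.comp (Computable.vector_ofFn fun i =>
    show Computable fun a => f a i from hf.comp Computable.id (Computable.const i))).of_eq
      fun a => by funext i; simp

lemma primrec_activeAt (D : Fin n → Bool) (T : ℕ) : Primrec₂ (activeAt D T) :=
  Primrec.or.comp ((Primrec.dom_finite D).comp Primrec.snd)
    ((Primrec.nat_le.comp (Primrec.const T) Primrec.fst).decide)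

lemma primrec_arrivesAt (D : Fin n → Bool) (T : ℕ) :
    Primrec fun x : ℕ × ℕ × Fin n => arrivesAt D T x.1 x.2.1 x.2.2 := by
  have ht : Primrec fun x : ℕ × ℕ × Fin n => x.1 := Primrec.fst
  have hs : Primrec fun x : ℕ × ℕ × Fin n => x.2.1 := Primrec.fst.comp Primrec.snd
  have hq : Primrec fun x : ℕ × ℕ × Fin n => x.2.2 := Primrec.snd.comp Primrec.snd
  exact Primrec.and.comp (Primrec.nat_lt.comp hs ht).decide
    (Primrec.and.comp ((primrec_activeAt D T).comp ht hq)
      (Primrec.or.comp (Primrec.nat_le.comp ht (Primrec.succ.comp hs)).decide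
        (Primrec.not.comp ((primrec_activeAt D T).comp (Primrec.pred.comp ht) hq))))

lemma primrec_sentAt :
    Primrec fun x : List (Round n) × ℕ × Fin n × Fin n =>
      sentAt x.1 x.2.1 x.2.2.1 x.2.2.2 :=
  Primrec.fin_app.comp (Primrec.fin_app.comp
    ((Primrec.list_getD _).comp Primrec.fst (Primrec.fst.comp Primrec.snd))
    (Primrec.fst.comp (Primrec.snd.comp Primrec.snd)))
    (Primrec.snd.comp (Primrec.snd.comp Primrec.snd))

lemma primrec_inboxAt (D : Fin n → Bool) (T : ℕ) :
    Primrec fun x : List (Round n) × ℕ × Fin n => inboxAt D T x.1 x.2.1 x.2.2 := by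
  refine Primrec.list_flatMap (Primrec.list_range.comp (Primrec.fst.comp Primrec.snd))
    (Primrec.listFilterMap (Primrec.const (List.finRange n)) ?_)
  have hx : Primrec fun y : ((List (Round n) × ℕ × Fin n) × ℕ) × Fin n => y.1.1 :=
    Primrec.fst.comp Primrec.fst
  have hs : Primrec fun y : ((List (Round n) × ℕ × Fin n) × ℕ) × Fin n => y.1.2 :=
    Primrec.snd.comp Primrec.fst
  have ht := Primrec.fst.comp (Primrec.snd.comp hx)
  have hq := Primrec.snd.comp (Primrec.snd.comp hx)
  refine Primrec.ite ?_ ?_ (Primrec.const none)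
  · exact Primrec.eq.comp ((primrec_arrivesAt D T).comp (ht.pair (hs.pair hq)))
      (Primrec.const true)
  · exact Primrec.option_map (primrec_sentAt.comp
      ((Primrec.fst.comp hx).pair (hs.pair (Primrec.snd.pair hq))))
      ((Primrec.snd.comp Primrec.fst).pair Primrec.snd)

lemma primrec_receivedAt (D : Fin n → Bool) (T : ℕ) :
    Primrec fun x : List (Round n) × ℕ × Fin n => receivedAt D T x.1 x.2.1 x.2.2 := by
  refine Primrec.list_map ?_ ?_
  · have hrel : PrimrecRel fun (t : ℕ) (p : Fin n) => activeAt D T t p = true :=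
      Primrec.eq.comp (primrec_activeAt D T) (Primrec.const true)
    refine (hrel.listFilter.comp
      (Primrec.list_range.comp (Primrec.succ.comp (Primrec.fst.comp Primrec.snd)))
      (Primrec.snd.comp Primrec.snd)).of_eq fun x => ?_
    simp
  · exact (primrec_inboxAt D T).comp ((Primrec.fst.comp Primrec.fst).pair
      (Primrec.snd.pair (Primrec.snd.comp (Primrec.snd.comp Primrec.fst))))

lemma primrec_mayAttach :
    Primrec fun x : List (Inbox n) × Fin n × Signature n => mayAttach x.1 x.2.1 x.2.2 := by
  have hmem : PrimrecRel fun (l : List (Signature n)) (x : Signature n) => ∃ y ∈ l, y = x :=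
    Primrec.eq.exists_mem_list
  have hl : Primrec fun x : List (Inbox n) × Fin n × Signature n =>
      x.1.flatten.flatMap fun y => y.2.2 :=
    Primrec.list_flatMap (Primrec.list_flatten.comp Primrec.fst)
      (Primrec.snd.comp (Primrec.snd.comp Primrec.snd))
  refine (PrimrecPred.or (Primrec.eq.comp
    (Primrec.fst.comp (Primrec.snd.comp Primrec.snd)) (Primrec.fst.comp Primrec.snd))
    (hmem.comp hl (Primrec.snd.comp Primrec.snd))).decide.of_eq fun x => ?_
  rw [Bool.eq_iff_iff, decide_eq_true_iff, mayAttach_iff]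
  simp only [exists_eq_right, List.mem_flatMap, List.mem_flatten]
  refine or_congr_right ⟨?_, ?_⟩
  · rintro ⟨y, ⟨b, hb, hy⟩, hx⟩
    exact ⟨b, hb, y, hy, hx⟩
  · rintro ⟨b, hb, y, hy, hx⟩
    exact ⟨y, ⟨b, hb, hy⟩, hx⟩

lemma primrec_restrict (S : Setup) :
    Primrec fun x : (List (Inbox n) × Fin n) × Msg n =>
      S.restrict (mayAttach x.1.1 x.1.2) x.2 := by
  cases S
  · exact (Primrec.fst.comp Primrec.snd).pair (Primrec.const [])
  · refine (Primrec.fst.comp Primrec.snd).pair ?_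
    -- The filtering predicate varies with the argument, so the filter is written as a `filterMap`.
    have : Primrec fun x : (List (Inbox n) × Fin n) × Msg n => x.2.2.filterMap fun y =>
        bif mayAttach x.1.1 x.1.2 y then some y else none := by
      refine Primrec.listFilterMap (Primrec.snd.comp Primrec.snd) ?_
      have h1 : Primrec fun y : ((List (Inbox n) × Fin n) × Msg n) × Signature n => y.1.1 :=
        Primrec.fst.comp Primrec.fst
      exact Primrec.cond (primrec_mayAttach.comp
        ((Primrec.fst.comp h1).pair ((Primrec.snd.comp h1).pair Primrec.snd)))
        (Primrec.option_some.comp Primrec.snd) (Primrec.const none)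
    refine this.of_eq fun x => ?_
    rw [← List.filterMap_eq_filter]
    congr 1
    funext y
    cases hy : mayAttach x.1.1 x.1.2 y <;> simp [Option.guard, hy]

variable {Vin Vout : Type*} [Primcodable Vin] [Primcodable Vout]
  (S : Setup) (P : Protocol n Vin Vout) (D : Fin n → Bool) (T : ℕ)

lemma computable_act {α : Type*} [Primcodable α] {a b : α → List Bool}
    {r : α → List (Inbox n)} {p : α → Fin n} (ha : Computable a) (hb : Computable b)
    (hr : Computable r) (hp : Computable p) :
    Computable₂ fun x (v : Vin) => P.act (p x) v (a x) (b x) (r x) := by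
  have h : Computable fun z : α × Vin => (p z.1, z.2, a z.1, b z.1, r z.1) :=
    (hp.comp Computable.fst).pair (Computable.snd.pair ((ha.comp Computable.fst).pair
      ((hb.comp Computable.fst).pair (hr.comp Computable.fst))))
  exact P.act_computable.comp h

lemma computable_take {α : Type*} [Primcodable α] {a : α → List Bool} {k : α → ℕ}
    (ha : Computable a) (hk : Computable k) : Computable fun x => (a x).take (k x) :=
  (Primrec₂.to_comp Primrec.list_take).comp hk ha

lemma computable_receivedAt {α : Type*} [Primcodable α] {h : α → List (Round n)} {t : α → ℕ}
    {p : α → Fin n} (hh : Computable h) (ht : Computable t) (hp : Computable p) :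
    Computable fun x => receivedAt D T (h x) (t x) (p x) := by
  have hpair : Computable fun x => (h x, t x, p x) := hh.pair (ht.pair hp)
  have hr : Computable fun x : List (Round n) × ℕ × Fin n => receivedAt D T x.1 x.2.1 x.2.2 :=
    (primrec_receivedAt D T).to_comp
  have := hr.comp hpair
  exact this

lemma computable_scheduledStep {α : Type*} [Primcodable α] {I : α → Fin n → Option Vin}
    {a b : α → List Bool} {h : α → List (Round n)} {t : α → ℕ} {p : α → Fin n}
    (hI : Computable I) (ha : Computable a) (hb : Computable b) (hh : Computable h)
    (ht : Computable t) (hp : Computable p) :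
    Computable fun x => scheduledStep P D T (I x) (a x) (b x) (h x) (t x) (p x) := by
  have hr := computable_receivedAt D T hh ht hp
  have hk := P.coins_computable.comp (Computable.list_length.comp hr)
  have hact := computable_act P (computable_take ha hk) (computable_take hb hk) hr hp
  have hactive : Computable fun x => activeAt D T (t x) (p x) :=
    (primrec_activeAt D T).to_comp.comp ht hp
  have hcond := Computable.cond (hactive.comp (Computable.fst (β := Vin))) hact
    (Computable.const (fun _ => none, none))
  have hIp : Computable fun x => I x (p x) := Computable.fin_app.comp hI hp
  refine (Computable.option_casesOn hIp (Computable.const (fun _ => none, none))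
    hcond.to₂).of_eq fun x => ?_
  simp only [scheduledStep]
  cases I x (p x) with
  | none => rfl
  | some v => cases activeAt D T (t x) (p x) <;> rfl

lemma computable_scheduledMsg {α : Type*} [Primcodable α] {I : α → Fin n → Option Vin}
    {a b : α → List Bool} {h : α → List (Round n)} {t : α → ℕ} {p q : α → Fin n}
    (hI : Computable I) (ha : Computable a) (hb : Computable b) (hh : Computable h)
    (ht : Computable t) (hp : Computable p) (hq : Computable q) :
    Computable fun x => scheduledMsg S P D T (I x) (a x) (b x) (h x) (t x) (p x) (q x) := by
  have hrp : Computable fun x => (receivedAt D T (h x) (t x) (p x), p x) :=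
    (computable_receivedAt D T hh ht hp).pair hp
  have hmsg : Computable fun x =>
      (scheduledStep P D T (I x) (a x) (b x) (h x) (t x) (p x)).1 (q x) :=
    Computable.fin_app.comp
      (Computable.fst.comp (computable_scheduledStep P D T hI ha hb hh ht hp)) hq
  have hpair : Computable fun z : α × Msg n =>
      ((receivedAt D T (h z.1) (t z.1) (p z.1), p z.1), z.2) :=
    (hrp.comp Computable.fst).pair Computable.snd
  have hrestrict := (primrec_restrict (n := n) S).to_comp.comp hpair
  exact Computable.option_map hmsg hrestrict.to₂

lemma isComputable_scheduled {send : AdvView n → Fin n → Fin n → Option (Msg n)}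
    (hsend : Computable fun x : AdvView n × Fin n × Fin n => send x.1 x.2.1 x.2.2) :
    (scheduled D T send).IsComputable :=
  ⟨hsend, Computable.const true, (primrec_activeAt D T).to_comp.comp
    (Computable.list_length.comp (Computable.snd.comp (Computable.snd.comp Computable.fst)))
    Computable.snd⟩

lemma allows_of_isComputable {A : Adversary n} (hA : A.IsComputable) : S.Allows A := by
  cases S
  · trivial
  · exact hA

lemma allows_silent : S.Allows (scheduled D T (silent (n := n))) :=
  allows_of_isComputable S (isComputable_scheduled D T (Computable.const none))

/-- `K`, `D` and `T` are finite data built into the adversary; beyond them it only runs the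
computable protocol on its view. -/
lemma allows_imitate (K : Fin n → Option Vin) :
    S.Allows (scheduled D T (imitate S P D T K)) := by
  refine allows_of_isComputable S (isComputable_scheduled D T ?_)
  have hh : Computable fun x : AdvView n × Fin n × Fin n => x.1.2.2.dropLast := by
    have hlen : Primrec fun l : List (Round n) => l.length - 1 :=
      Primrec.pred.comp Primrec.list_length
    have : Primrec fun l : List (Round n) => l.dropLast :=
      (Primrec.list_take.comp hlen Primrec.id).of_eq fun l => by
        simp [List.dropLast_eq_take]
    exact this.to_comp.comp (Computable.snd.comp (Computable.snd.comp Computable.fst))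
  have hp : Computable fun x : AdvView n × Fin n × Fin n => x.2.1 :=
    Computable.fst.comp Computable.snd
  exact computable_scheduledMsg S P D T (Computable.const K)
    (Computable.fin_app.comp (Computable.fst.comp Computable.fst) hp)
    (Computable.fst.comp (Computable.snd.comp Computable.fst)) hh
    (Computable.list_length.comp hh) hp (Computable.snd.comp Computable.snd)

/-- The tapes with ones at the positions in `c` and zeros elsewhere. -/
def finiteCoins (c : List (Option (Fin n) × ℕ)) : Coins n := fun x => decide (x ∈ c)

lemma primrec_firstCoins_finiteCoins :
    Primrec fun x : List (Option (Fin n) × ℕ) × Option (Fin n) × ℕ =>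
      firstCoins (finiteCoins x.1) x.2.1 x.2.2 := by
  have hmem : PrimrecRel fun (l : List (Option (Fin n) × ℕ)) x => ∃ y ∈ l, y = x :=
    Primrec.eq.exists_mem_list
  refine Primrec.list_map (Primrec.list_range.comp (Primrec.snd.comp Primrec.snd)) ?_
  refine (hmem.comp (Primrec.fst.comp Primrec.fst)
    ((Primrec.fst.comp (Primrec.snd.comp Primrec.fst)).pair Primrec.snd)).decide.of_eq fun x => ?_
  simp [finiteCoins]

lemma computable_firstCoins_finiteCoins {α : Type*} [Primcodable α]
    {c : α → List (Option (Fin n) × ℕ)} {i : α → Option (Fin n)} {k : α → ℕ}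
    (hc : Computable c) (hi : Computable i) (hk : Computable k) :
    Computable fun x => firstCoins (finiteCoins (c x)) (i x) (k x) :=
  primrec_firstCoins_finiteCoins.to_comp.comp (hc.pair (hi.pair hk))

lemma computable_round {α : Type*} [Primcodable α] {I : α → Fin n → Option Vin}
    {c : α → List (Option (Fin n) × ℕ)} {h : α → List (Round n)}
    (hI : Computable I) (hc : Computable c) (hh : Computable h) :
    Computable fun x => (fun p q => scheduledMsg S P D T (I x)
      (firstCoins (finiteCoins (c x)) (some p) (P.coins ((h x).length + 1)))
      (firstCoins (finiteCoins (c x)) none (P.coins ((h x).length + 1)))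
      (h x) (h x).length p q : Round n) := by
  refine computable_fin_curry (computable_fin_curry ?_)
  have hx : Computable fun z : (α × Fin n) × Fin n => z.1.1 :=
    Computable.fst.comp Computable.fst
  have hp : Computable fun z : (α × Fin n) × Fin n => z.1.2 :=
    Computable.snd.comp Computable.fst
  have hq : Computable fun z : (α × Fin n) × Fin n => z.2 := Computable.snd
  have ht := Computable.list_length.comp (hh.comp hx)
  have hk := P.coins_computable.comp (Computable.succ.comp ht)
  exact computable_scheduledMsg S P D T (hI.comp hx)
    (computable_firstCoins_finiteCoins (hc.comp hx) (Computable.option_some.comp hp) hk)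
    (computable_firstCoins_finiteCoins (hc.comp hx) (Computable.const none) hk)
    (hh.comp hx) ht hp hq

/-- Tapes with finitely many ones have codes, so the run can be simulated round by round, uniformly
in the inputs and the tapes. -/
lemma computable_transcript {α : Type*} [Primcodable α] {I : α → Fin n → Option Vin}
    {c : α → List (Option (Fin n) × ℕ)} {t : α → ℕ}
    (hI : Computable I) (hc : Computable c) (ht : Computable t) :
    Computable fun x => transcript S P (scheduled D T silent) (I x) (finiteCoins (c x)) (t x) := by
  have hx : Computable fun z : α × ℕ × List (Round n) => z.1 := Computable.fst
  have hh : Computable fun z : α × ℕ × List (Round n) => z.2.2 :=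
    Computable.snd.comp Computable.snd
  have hround := computable_round S P D T (hI.comp hx) (hc.comp hx) hh
  have hstep := Computable.list_concat.comp hh hround
  refine (Computable.nat_rec (g := fun _ => ([] : List (Round n))) ht
    (Computable.const _) hstep.to₂).of_eq fun x => ?_
  induction t x with
  | zero => rfl
  | succ t ih =>
    rw [transcript, ← ih]
    dsimp only
    congr 2
    funext p q
    exact (nextRound_silent S P D T (I x) (finiteCoins (c x)) le_rfl p q).symm

lemma computable_outputAt {α : Type*} [Primcodable α] {I : α → Fin n → Option Vin}
    {c : α → List (Option (Fin n) × ℕ)} {t : α → ℕ} {p : α → Fin n}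
    (hI : Computable I) (hc : Computable c) (ht : Computable t) (hp : Computable p) :
    Computable fun x =>
      outputAt S P (scheduled D T silent) (I x) (finiteCoins (c x)) (t x) (p x) := by
  have hk := P.coins_computable.comp (Computable.succ.comp ht)
  have hstep := computable_scheduledStep P D T hI
    (computable_firstCoins_finiteCoins hc (Computable.option_some.comp hp) hk)
    (computable_firstCoins_finiteCoins hc (Computable.const none) hk)
    (computable_transcript S P D T hI hc ht) ht hp
  refine (Computable.snd.comp hstep).of_eq fun x => ?_
  exact (outputAt_scheduled S P D T silent (I x) (finiteCoins (c x)) le_rfl (p x)).symm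

/-- The result of the first execution found in which an honest party decides, among the executions
in which the corrupted parties are silent and the messages arrive at once. -/
def firstDecision (I : Fin n → Option Vin) : Part Vout :=
  Nat.rfindOpt fun k =>
    (Encodable.decode k : Option (List (Option (Fin n) × ℕ) × ℕ × Fin n)).bind fun y =>
      outputAt S P (scheduled (fun _ => true) 0 silent) I (finiteCoins y.1) y.2.1 y.2.2

lemma partrec_firstDecision : Partrec (firstDecision S P) := by
  have hx : Computable fun z : ((Fin n → Option Vin) × ℕ) ×
      List (Option (Fin n) × ℕ) × ℕ × Fin n => z.1.1 := Computable.fst.comp Computable.fst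
  have hy : Computable fun z : ((Fin n → Option Vin) × ℕ) ×
      List (Option (Fin n) × ℕ) × ℕ × Fin n => z.2 := Computable.snd
  have hout := computable_outputAt S P (fun _ => true) 0 hx (Computable.fst.comp hy)
    (Computable.fst.comp (Computable.snd.comp hy)) (Computable.snd.comp (Computable.snd.comp hy))
  have hdec : Computable fun z : (Fin n → Option Vin) × ℕ =>
      (Encodable.decode z.2 : Option (List (Option (Fin n) × ℕ) × ℕ × Fin n)) :=
    Computable.decode.comp Computable.snd
  have hbind := Computable.option_bind hdec hout.to₂
  exact Partrec.rfindOpt hbind.to₂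

variable {S P}

lemma exists_of_mem_firstDecision {I : Fin n → Option Vin} {v : Vout}
    (hv : v ∈ firstDecision S P I) : ∃ c t p,
      outputAt S P (scheduled (fun _ => true) 0 silent) I (finiteCoins c) t p = some v := by
  obtain ⟨k, hk⟩ := Nat.rfindOpt_spec hv
  obtain ⟨y, -, hy⟩ := Option.bind_eq_some_iff.1 hk
  exact ⟨y.1, y.2.1, y.2.2, hy⟩

/-- A decision at time t reads only the first `P.coins (t + 1)` bits of each tape, so replacing all
later bits by zeros yields a run that the search examines. -/
lemma firstDecision_dom {I : Fin n → Option Vin} {ω : Coins n} {t : ℕ} {p : Fin n} {v : Vout}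
    (hv : outputAt S P (scheduled (fun _ => true) 0 silent) I ω t p = some v) :
    (firstDecision S P I).Dom := by
  classical
  let c : List (Option (Fin n) × ℕ) :=
    ((Finset.univ ×ˢ Finset.range (P.coins (t + 1))).filter fun x => ω x = true).toList
  -- `outputAt_delayed` compares runs at the waking time itself, so t is taken as waking time here
  -- and changed back to 0 below. As everybody is always awake, it has no effect.
  have hc : outputAt S P (scheduled (fun _ => true) t silent) I (finiteCoins c) t p = some v := by
    rw [← hv]
    refine outputAt_delayed S P _ t (fun _ _ => rfl) (fun _ _ => rfl) (fun i j hj => ?_) rfl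
    rw [finiteCoins, Bool.eq_iff_iff, decide_eq_true_iff]
    simp [c, hj]
  have hc' : outputAt S P (scheduled (fun _ => true) 0 silent) I (finiteCoins c) t p =
      some v := by
    rw [← hc]
    exact (outputAt_delayed S P _ t (fun _ _ => rfl) (fun _ _ => rfl) (fun _ _ _ => rfl) rfl).symm
  refine Nat.rfindOpt_dom.2 ⟨Encodable.encode (c, t, p), v, ?_⟩
  simpa [Encodable.encodek] using hc'

end Computability

/-! ### Randomness -/

section Randomness

variable {n : ℕ}

instance : IsProbabilityMeasure (coinMeasure n) := by
  unfold coinMeasure; infer_instance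

/-- This is a cylinder over finitely many coordinates: its measure is a finite product of factors
1/2. -/
lemma coinMeasure_pos (ω : Coins n) (k : ℕ) :
    0 < coinMeasure n {ω' | ∀ i, ∀ j < k, ω' (i, j) = ω (i, j)} := by
  have hset : {ω' : Coins n | ∀ i, ∀ j < k, ω' (i, j) = ω (i, j)} =
      Set.pi ((Finset.univ ×ˢ Finset.range k : Finset (Option (Fin n) × ℕ)) :
        Set (Option (Fin n) × ℕ)) fun x => {ω x} := by
    ext ω'
    simp [Set.mem_pi]
  rw [hset, coinMeasure, Measure.infinitePi_pi _ fun _ _ => MeasurableSet.singleton _]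
  refine pos_iff_ne_zero.2 (Finset.prod_ne_zero_iff.2 fun x _ => ?_)
  rw [PMF.toMeasure_apply_singleton _ _ (MeasurableSet.singleton _)]
  simp

variable {Vin Vout : Type*} [Primcodable Vin] [Primcodable Vout]
  {S : Setup} {P : Protocol n Vin Vout} {A : Adversary n} {I : Fin n → Option Vin}

/-- A party that terminates with probability one decides in some execution that starts with given
coins. -/
lemma ProbabilisticTermination.exists_output (H : ProbabilisticTermination S P A I) {p : Fin n}
    (hp : p ∈ parties I) (ω : Coins n) (k : ℕ) :
    ∃ ω', (∀ i, ∀ j < k, ω' (i, j) = ω (i, j)) ∧ ∃ t v, outputAt S P A I ω' t p = some v := by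
  obtain ⟨t, ht⟩ := ((H p hp).eventually (gt_mem_nhds (coinMeasure_pos ω k))).exists
  by_contra! hc
  -- If no run with these first coins decided, the cylinder would lie inside the undecided event,
  -- whose measure is smaller at time t. Monotonicity needs no measurability of that event.
  refine ht.not_ge (measure_mono fun ω' hω' t' _ => ?_)
  exact Option.eq_none_iff_forall_ne_some.2 (hc ω' hω' t')

end Randomness

/-! ### Input configurations -/

section InputConfig

variable {n ts : ℕ} {Vin : Type*}

lemma InputConfig.exists_mem_parties (hts : ts < n) (I : InputConfig n ts Vin) :
    ∃ p, p ∈ parties I.1 := by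
  refine Finset.card_pos.1 ?_
  have := I.2
  omega

lemma mem_parties {I : Fin n → Option Vin} {p : Fin n} : p ∈ parties I ↔ (I p).isSome := by
  simp [parties]

/-- The union of two neighbors. -/
def InputConfig.union (I J : InputConfig n ts Vin) : InputConfig n ts Vin :=
  ⟨fun p => (I.1 p).or (J.1 p), I.2.trans (Nat.add_le_add_right (Finset.card_le_card fun p hp => by
    rw [mem_parties] at hp ⊢
    simp [hp]) _)⟩

lemma InputConfig.sub_union_left (I J : InputConfig n ts Vin) : I.Sub (I.union J) := by
  intro p v hv
  simp [InputConfig.union, hv]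

lemma InputConfig.sub_union_right {I J : InputConfig n ts Vin} (h : J ∈ neighbors I) :
    J.Sub (I.union J) := by
  intro p v hv
  cases hI : I.1 p with
  | none => simp [InputConfig.union, hv, hI]
  | some u => simp [InputConfig.union, hI, h p u v hI hv]

end InputConfig

/-! ### Similar configurations -/

section Similarity

variable {n ts : ℕ} {Vin Vout : Type*} [Primcodable Vin] [Primcodable Vout]

lemma isSome_of_outputAt {S : Setup} {P : Protocol n Vin Vout} {A : Adversary n}
    {I : Fin n → Option Vin} {ω : Coins n} {t : ℕ} {p : Fin n} {v : Vout}
    (h : outputAt S P A I ω t p = some v) : (I p).isSome := by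
  by_contra hp
  rw [Option.not_isSome_iff_eq_none] at hp
  simp [outputAt, honestStep, hp] at h

/-- The outputs of the honest parties `I`, when the others are silent, are valid for the honest
parties `J`, provided that an execution with the honest parties `K ⊇ I ∪ J` in which the parties
outside `I` are delayed is legal. -/
lemma Secure.mem_of_outputAt {S : Setup} {Δ ta : ℕ} {Val : ValidityProperty n ts Vin Vout}
    {P : Protocol n Vin Vout} (H : Secure S Δ ta Val P) (hts : ts < n)
    {I J K : InputConfig n ts Vin} (net : Network)
    (hJ : n ≤ (parties J.1).card + net.threshold ts ta)
    (hIK : I.Sub K) (hJK : J.Sub K)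
    (hnet : ∀ (L : Fin n → Option Vin) T send ω, (∀ p ∈ parties L, p ∈ parties K.1) →
      RespectsNetwork S P (scheduled (fun p => (I.1 p).isSome) T send) L ω Δ net)
    {T' T : ℕ} {ω : Coins n} {p : Fin n} {v : Vout}
    (hv : outputAt S P (scheduled (fun _ => true) T' silent) I.1 ω T p = some v) :
    v ∈ Val J := by
  have sub_parties : ∀ {L : InputConfig n ts Vin}, L.Sub K → ∀ p ∈ parties L.1,
      p ∈ parties K.1 := fun hL p hp => by
    obtain ⟨w, hw⟩ := Option.isSome_iff_exists.1 (mem_parties.1 hp)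
    exact mem_parties.2 (by simp [hL p w hw])
  have hp := isSome_of_outputAt hv
  have hK : n ≤ (parties K.1).card + net.threshold ts ta :=
    hJ.trans (Nat.add_le_add_right (Finset.card_le_card (sub_parties hJK)) _)
  -- Security is used twice under the same schedule: for honest K, termination and agreement; for
  -- honest J with K \ J imitated, validity.
  obtain ⟨hterm, hagree, -⟩ := H net K hK (scheduled (fun p => (I.1 p).isSome) T silent)
    (allows_silent S _ T) fun ω => hnet _ _ _ _ fun _ h => h
  obtain ⟨-, -, hvalid⟩ := H net J hJ
    (scheduled (fun p => (I.1 p).isSome) T (imitate S P (fun p => (I.1 p).isSome) T K.1))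
    (allows_imitate S P _ T K.1) fun ω => hnet _ _ _ _ (sub_parties hJK)
  -- The decider p may be corrupted in J, so the value has to be carried over to a party q of J.
  obtain ⟨q, hq⟩ := J.exists_mem_parties hts
  obtain ⟨ω', hω', t, w, hw⟩ :=
    hterm.exists_output (sub_parties hJK q hq) ω (P.coins (T + 1))
  have hv' : outputAt S P (scheduled (fun p => (I.1 p).isSome) T silent) K.1 ω' T p = some v := by
    rw [← hv]
    refine outputAt_delayed S P _ T (fun _ h => h) (fun p hp => ?_) hω' hp
    obtain ⟨u, hu⟩ := Option.isSome_iff_exists.1 hp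
    rw [hu, hIK p u hu]
  obtain rfl := hagree ω' p (sub_parties hIK p (mem_parties.2 hp)) q (sub_parties hJK q hq)
    T t v w hv' hw
  exact hvalid ω' q hq t v (by rw [outputAt_imitate S P _ T ω' hJK t hq, hw])

/-- If J ⊆ I, then K = I has no delayed honest party and the synchronous guarantee applies. If |J| ≥
n - ta, then K = I ∪ J is a configuration because I and J are neighbors agreeing on common parties,
and delaying J \ I until T is legal in an asynchronous network. -/
lemma Secure.mem_of_similar {S : Setup} {Δ ta : ℕ} {Val : ValidityProperty n ts Vin Vout}
    {P : Protocol n Vin Vout} (H : Secure S Δ ta Val P) (hts : ts < n) (hΔ : 0 < Δ)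
    {I J : InputConfig n ts Vin} (hJ : J ∈ similar ta I)
    {T' T : ℕ} {ω : Coins n} {p : Fin n} {v : Vout}
    (hv : outputAt S P (scheduled (fun _ => true) T' silent) I.1 ω T p = some v) :
    v ∈ Val J := by
  rcases hJ with ⟨-, hJI⟩ | ⟨hJI, hcard⟩
  · exact H.mem_of_outputAt hts (K := I) .synchronous J.2 (fun _ _ h => h) hJI
      (fun L T send ω hL => respectsNetwork_synchronous S P _ T send L ω hΔ
        fun p hp => mem_parties.1 (hL p hp)) hv
  · exact H.mem_of_outputAt hts .asynchronous hcard (I.sub_union_left J)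
      (InputConfig.sub_union_right hJI)
      (fun L T send ω _ => respectsNetwork_asynchronous S P _ T send L ω Δ) hv

/-- Since ts < n there is an honest party, and in the synchronous run with silent corrupted parties
it decides for some coins. -/
lemma Secure.firstDecision_dom {S : Setup} {Δ ta : ℕ} {Val : ValidityProperty n ts Vin Vout}
    {P : Protocol n Vin Vout} (H : Secure S Δ ta Val P) (hts : ts < n) (hΔ : 0 < Δ)
    (I : InputConfig n ts Vin) : (firstDecision S P I.1).Dom := by
  obtain ⟨hterm, -, -⟩ := H .synchronous I I.2 (scheduled (fun _ => true) 0 silent)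
    (allows_silent S _ 0) fun ω =>
      respectsNetwork_synchronous S P _ 0 silent I.1 ω hΔ fun _ _ => rfl
  obtain ⟨p, hp⟩ := I.exists_mem_parties hts
  obtain ⟨ω, -, t, v, hv⟩ := hterm.exists_output hp (fun _ => false) 0
  exact BA.firstDecision_dom hv

end Similarity

end BA

theorem mainTheorem4 {Vin Vout : Type*} [Primcodable Vin] [Primcodable Vout]
    (n ts ta Δ : ℕ) (hts : ts < n) (hta : ta ≤ ts) (hΔ : 0 < Δ) (S : BA.Setup)
    (Val : BA.ValidityProperty n ts Vin Vout) (hVal : BA.Solvable S Δ ta Val) :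
    BA.SimilarityCondition ta Val := by
  obtain ⟨P, hP⟩ := hVal
  refine ⟨fun I => (BA.firstDecision S P I.1).get (hP.firstDecision_dom hts hΔ I),
    ⟨BA.firstDecision S P, BA.partrec_firstDecision S P, fun I => Part.get_mem _⟩, fun I => ?_⟩
  obtain ⟨c, t, p, hv⟩ := BA.exists_of_mem_firstDecision
    (Part.get_mem (hP.firstDecision_dom hts hΔ I))
  exact Set.mem_iInter₂.2 fun J hJ => hP.mem_of_similar hts hΔ hJ hv
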